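/- Let $\mathcal P$ be a finite set of processes and $\widetilde\Sigma=\{\Sigma_i\}_{i\in\mathcal P}$ a distributed alphabet whose set of letters $\Sigma=\bigcup_{i}\Sigma_i$ is finite and non-empty; put $\mathrm{loc}(a)=\{i\in\mathcal P: a\in\Sigma_i\}$. A trace is a finite $\Sigma$-labelled poset $t=(E,\le,\lambda)$ such that $\mathrm{loc}(\lambda(e))\cap\mathrm{loc}(\lambda(e'))\ne\emptyset$ whenever $e'$ covers $e$, and such that $e\le e'$ or $e'\le e$ whenever $\mathrm{loc}(\lambda(e))\cap\mathrm{loc}(\lambda(e'))\neq\emptyset$. Let $E_i=\{e\in E: i\in\mathrm{loc}(\lambda(e))\}$. The logic $\mathsf{LocTL}[\mathsf Y_i,\mathsf S_i]$ has event formulas $\alpha ::= a\mid\neg\alpha\mid\alpha\vee\alpha\mid\mathsf Y_i\alpha\mid\alpha\,\mathsf S_i\,\alpha$ and trace formulas $\beta ::= \exists_i\alpha\mid\neg\beta\mid\beta\vee\beta$ ($a\in\Sigma$, $i\in\mathcal P$). Here $t,e\models a$ iff $\lambda(e)=a$; $t,e\models\mathsf Y_i\alpha$ iff there is a greatest event $f$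 of $\{f\in E_i: f<e\}$ and $t,f\models\alpha$; $t,e\models\alpha\,\mathsf S_i\,\alpha'$ iff $e\in E_i$ and there is $f\in E_i$ with $f<e$, $t,f\models\alpha'$, and $t,g\models\alpha$ for all $g\in E_i$ with $f<g<e$; and $t\models\exists_i\alpha$ iff $E_i$ has a greatest event $e$ and $t,e\models\alpha$. Boolean connectives are interpreted as usual. $\mathsf{LocTL}[\mathsf S_i]$ is the fragment without the operators $\mathsf Y_i$. An asynchronous automaton $A=(\{S_i\},\{\delta_a\},s_{\mathrm{in}})$ over $\widetilde\Sigma$ has finite non-empty sets $S_i$ ($i\in\mathcal P$) of local states, maps $\delta_a:S_a\to S_a$ for $a\in\Sigma$, where $S_a=\prod_{i\in\mathrm{loc}(a)}S_i$, and an initial global state $s_{\mathrm{in}}\in S_{\mathcal P}=\prod_{i\in\mathcal P}S_i$. Let $\Delta_a:S_{\mathcal P}\to S_{\mathcal P}$ be the extension of $\delta_a$ leaving the components outside $\mathrm{loc}(a)$ unchanged. The run of $A$ on $t$ is the unique map $\rho_t$ from the downward closed subsets of $E$ to $S_{\mathcal P}$ with $\rho_t(\emptyset)=s_{\mathrm{in}}$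 and $\rho_t(c\cup\{e\})=\Delta_{\lambda(e)}(\rho_t(c))$ whenever $e\notin c$ and $c$, $c\cup\{e\}$ are downward closed. A language $L$ of traces is recognized by $A$ if $L=\{t:\rho_t(E)\in F\}$ for some $F\subseteq S_{\mathcal P}$. For $\ell\in\mathcal P$, a $U_2[\ell]$ automaton is an asynchronous automaton with $|S_\ell|=2$ and $|S_i|=1$ for $i\ne\ell$, for which there are disjoint subsets $R_1,R_2\subseteq\Sigma_\ell$ such that the letters of $R_1$ (resp. $R_2$) reset the state of $\ell$ to the first (resp. second) element of $S_\ell$ and all other letters leave the state unchanged. The local cascade product of $A=(\{S_i\},\{\delta_a\},s_{\mathrm{in}})$ over $\widetilde\Sigma$ and $B=(\{Q_i\},\{\delta_{(a,s_a)}\},q_{\mathrm{in}})$ over the distributed alphabet of all pairs $(a,s_a)$, $a\in\Sigma$, $s_a\in S_a$, with $\mathrm{loc}(a,s_a)=\mathrm{loc}(a)$, is the automaton over $\widetilde\Sigma$ with local states $S_i\times Q_i$, initial state $(s_{\mathrm{in}},q_{\mathrm{in}})$ and transitions $(s_a,q_a)\mapsto(\delta_a(s_a),\delta_{(a,s_a)}(q_a))$.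 A local cascade product of $U_2[\ell]$ automata is an automaton obtained from $U_2[\ell]$ automata (with $\ell\in\mathcal P$ possibly varying, and at least one factor) by iterating this binary operation. Theorem. A language of traces over $\widetilde\Sigma$ is defined by a $\mathsf{LocTL}[\mathsf S_i]$ trace formula if and only if it is recognized by a local cascade product of $U_2[\ell]$ automata. -/

import Mathlib

universe u

namespace LocalCascade

/-- A distributed alphabet over the set `P` of processes: a family `sub i` of subsets
(the alphabets of the processes) covering a finite set of letters. -/
structure DistAlphabet (P : Type u) where
  Letter : Type u
  finite_letter : Finite Letter
  sub : P → Set Letter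
  exists_mem_sub : ∀ a, ∃ i, a ∈ sub i

/-- The set of processes participating in the letter `a`. -/
@[reducible] def DistAlphabet.loc {P : Type u} (D : DistAlphabet P) (a : D.Letter) : Set P :=
  {i | a ∈ D.sub i}

/-- Two letters are dependent if they share a process. -/
def DistAlphabet.Dep {P : Type u} (D : DistAlphabet P) (a b : D.Letter) : Prop :=
  (D.loc a ∩ D.loc b).Nonempty

/-- Traces, as finite labelled posets. -/
structure Trace {P : Type u} (D : DistAlphabet P) where
  Event : Type
  [finite_event : Finite Event]
  [order : PartialOrder Event]
  label : Event → D.Letter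
  dep_of_covBy : ∀ e e' : Event, e ⋖ e' → D.Dep (label e) (label e')
  le_or_le_of_dep : ∀ e e' : Event, D.Dep (label e) (label e') → e ≤ e' ∨ e' ≤ e

attribute [instance] Trace.finite_event Trace.order

/-- The events in which process `i` participates. -/
def Trace.procEvents {P : Type u} {D : DistAlphabet P} (t : Trace D) (i : P) : Set t.Event :=
  {e | i ∈ D.loc (t.label e)}

/-! ### Asynchronous automata -/

/-- Deterministic asynchronous automata; every set of local states is finite, and
nonempty because of `init`. -/
structure AsyncAutomaton {P : Type u} (D : DistAlphabet P) where
  State : P → Type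
  finite_state : ∀ i, Finite (State i)
  step : ∀ a : D.Letter, (∀ i : D.loc a, State i) → (∀ i : D.loc a, State i)
  init : ∀ i, State i

namespace AsyncAutomaton

variable {P : Type u} {D : DistAlphabet P}

/-- Global states. -/
abbrev Global (A : AsyncAutomaton D) : Type u := ∀ i : P, A.State i

open Classical in
/-- The extension of the transition function of the letter `a` to global states. -/
noncomputable def globalStep (A : AsyncAutomaton D) (a : D.Letter) (s : A.Global) : A.Global :=
  fun i => if h : i ∈ D.loc a then A.step a (fun j => s j) ⟨i, h⟩ else s i

/-- Trace runs: maps from configurations (lower sets of events) to global states that start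
in the initial state and respect every one-event extension of a configuration. -/
structure IsRun (A : AsyncAutomaton D) (t : Trace D) (ρ : LowerSet t.Event → A.Global) :
    Prop where
  init : ρ ⊥ = A.init
  step : ∀ (c c' : LowerSet t.Event) (e : t.Event), e ∉ c →
    (c' : Set t.Event) = (c : Set t.Event) ∪ {e} → A.globalStep (t.label e) (ρ c) = ρ c'

/-- `A` accepts the language `L` if, for some set `F` of final global states, `L` consists of
the traces on which the run of `A` ends in `F`. -/
def Accepts (A : AsyncAutomaton D) (L : Set (Trace D)) : Prop :=
  ∃ F : Set A.Global, L = {t | ∃ ρ, A.IsRun t ρ ∧ ρ ⊤ ∈ F}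

end AsyncAutomaton

/-! ### Local cascade products -/

/-- The alphabet of pairs `(a, s_a)` of a letter `a` and a joint state `s_a` of the processes
participating in `a`; the processes participating in `(a, s_a)` are those of `a`. -/
def DistAlphabet.extend {P : Type u} [Finite P] (D : DistAlphabet P) (A : AsyncAutomaton D) :
    DistAlphabet P where
  Letter := Σ a : D.Letter, ∀ i : D.loc a, A.State i
  finite_letter :=
    have := D.finite_letter
    have := A.finite_state
    inferInstance
  sub i := {x | x.1 ∈ D.sub i}
  exists_mem_sub x := D.exists_mem_sub x.1

/-- The local cascade product of `A` and `B`, where `B` reads letters of `A`'s alphabet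
together with the local states of `A`. -/
def AsyncAutomaton.cascade {P : Type u} [Finite P] {D : DistAlphabet P} (A : AsyncAutomaton D)
    (B : AsyncAutomaton (D.extend A)) : AsyncAutomaton D where
  State i := A.State i × B.State i
  finite_state i :=
    have := A.finite_state i
    have := B.finite_state i
    inferInstance
  step a x := fun i =>
    (A.step a (fun j => (x j).1) i, B.step ⟨a, fun j => (x j).1⟩ (fun j => (x j).2) i)
  init i := (A.init i, B.init i)

/-- `A` is a reset automaton `U₂[ℓ]`: process `ℓ` has exactly two states `q₁`, `q₂`, every
other process has one state, the letters of two disjoint subsets `R₁`, `R₂` of the alphabet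
of `ℓ` reset the state of `ℓ` to `q₁`, `q₂` respectively, and all other letters
do not change the state. -/
def AsyncAutomaton.IsU2 {P : Type u} {D : DistAlphabet P} (ℓ : P) (A : AsyncAutomaton D) :
    Prop :=
  (∀ i, i ≠ ℓ → Nat.card (A.State i) = 1) ∧
  ∃ (q₁ q₂ : A.State ℓ) (R₁ R₂ : Set D.Letter),
    q₁ ≠ q₂ ∧ (∀ q, q = q₁ ∨ q = q₂) ∧
    R₁ ⊆ D.sub ℓ ∧ R₂ ⊆ D.sub ℓ ∧ Disjoint R₁ R₂ ∧
    (∀ a ∈ R₁, ∀ s, A.globalStep a s ℓ = q₁) ∧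
    (∀ a ∈ R₂, ∀ s, A.globalStep a s ℓ = q₂) ∧
    (∀ a, a ∉ R₁ → a ∉ R₂ → ∀ s, A.globalStep a s = s)

/-- `A` is a local cascade product of (one or more) automata `U₂[ℓ]`, where `ℓ` may differ
from factor to factor, with any bracketing. -/
inductive IsU2Cascade {P : Type u} [Finite P] : ∀ D : DistAlphabet P, AsyncAutomaton D → Prop
  | single (D : DistAlphabet P) (A : AsyncAutomaton D) (ℓ : P) (hA : A.IsU2 ℓ) :
      IsU2Cascade D A
  | cascade (D : DistAlphabet P) (A : AsyncAutomaton D) (B : AsyncAutomaton (D.extend A))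
      (hA : IsU2Cascade D A) (hB : IsU2Cascade (D.extend A) B) :
      IsU2Cascade D (A.cascade B)

/-! ### The local temporal logic -/

/-- Event formulas of `LocTL[Y_i, S_i]`. -/
inductive EventFormula {P : Type u} (D : DistAlphabet P) : Type u
  | letter (a : D.Letter) : EventFormula D
  | neg (α : EventFormula D) : EventFormula D
  | or (α α' : EventFormula D) : EventFormula D
  | yesterday (i : P) (α : EventFormula D) : EventFormula D
  | since (i : P) (α α' : EventFormula D) : EventFormula D

/-- Trace formulas of `LocTL[Y_i, S_i]`. -/
inductive TraceFormula {P : Type u} (D : DistAlphabet P) : Type u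
  | ex (i : P) (α : EventFormula D) : TraceFormula D
  | neg (β : TraceFormula D) : TraceFormula D
  | or (β β' : TraceFormula D) : TraceFormula D

/-- Truth of an event formula at an event of a trace. -/
def EventFormula.Holds {P : Type u} {D : DistAlphabet P} (t : Trace D) :
    EventFormula D → t.Event → Prop
  | .letter a, e => t.label e = a
  | .neg α, e => ¬ α.Holds t e
  | .or α α', e => α.Holds t e ∨ α'.Holds t e
  | .yesterday i α, e =>
      ∃ f, Maximal (fun x => x < e ∧ x ∈ t.procEvents i) f ∧ α.Holds t f
  | .since i α α', e =>
      e ∈ t.procEvents i ∧ ∃ f ∈ t.procEvents i, f < e ∧ α'.Holds t f ∧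
        ∀ g ∈ t.procEvents i, f < g → g < e → α.Holds t g

/-- Truth of a trace formula. -/
def TraceFormula.Holds {P : Type u} {D : DistAlphabet P} (t : Trace D) : TraceFormula D → Prop
  | .ex i α => ∃ e, Maximal (fun x => x ∈ t.procEvents i) e ∧ α.Holds t e
  | .neg β => ¬ β.Holds t
  | .or β β' => β.Holds t ∨ β'.Holds t

/-- Event formulas of the fragment `LocTL[S_i]`: the operators `Y_i` do not occur. -/
def EventFormula.YFree {P : Type u} {D : DistAlphabet P} : EventFormula D → Prop
  | .letter _ => True
  | .neg α => α.YFree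
  | .or α α' => α.YFree ∧ α'.YFree
  | .yesterday _ _ => False
  | .since _ α α' => α.YFree ∧ α'.YFree

/-- Trace formulas of the fragment `LocTL[S_i]`. -/
def TraceFormula.YFree {P : Type u} {D : DistAlphabet P} : TraceFormula D → Prop
  | .ex _ α => α.YFree
  | .neg β => β.YFree
  | .or β β' => β.YFree ∧ β'.YFree

/-- The trace language defined by a trace formula. -/
def TraceFormula.language {P : Type u} {D : DistAlphabet P} (β : TraceFormula D) :
    Set (Trace D) :=
  {t | β.Holds t}

end LocalCascade

/-!
A process of an asynchronous automaton changes state only at its own events, and the events of one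
process are linearly ordered. So the state of process `i` in a configuration `c` is found by
looking at the last event of `i` in `c`; this gives the run by recursion on configurations
(`AsyncAutomaton.run`) and shows that an event `e` is always read in the states reached by its
strict past. Relabelling every event of a trace `t` by its letter and these states gives a trace
`t.extend A` over the alphabet of pairs, and the run of `A.cascade B` on `t` consists of the run of
`A` on `t` and the run of `B` on `t.extend A` (`AsyncAutomaton.cascade_run`).

The link with the logic is that `α S_i α'` is maintained by one bit of process `i`: when an event
of `i` is added, the bit is set if `α'` holds there, cleared if neither `α` nor `α'` does, and kept
otherwise (`Trace.sinceOn_insert`). This is a `U₂[i]` automaton reading the truth values of `α` and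
`α'`.

* From a formula to a cascade: each since subformula adds one such factor to the cascade built so
  far, after which its truth value at an event can be read off the letter and the local states
  there (`EventFormula.exists_cascade_computes`). The trace formula `∃_i α` asks for the bit of
  `⊥ S_i α` in the final state.
* From a cascade to a formula: the formulas describe the letters of `t.extend A` at the events of
  `t`. In a single `U₂[ℓ]` automaton with reset sets `R₁`, `R₂` the state of `ℓ` is the first one
  iff `(¬R₂) S_ℓ R₁` holds, or it is the initial one and no reset has happened
  (`AsyncAutomaton.run_eq_iff_of_reset`). For `A.cascade B`, a formula over the alphabet of pairs
  that describes the states of `B` is turned into one over the original alphabet by replacing its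
  letters by the formulas for `A`. As this applies to arbitrary products, the bracketing of the
  cascade is irrelevant (`IsU2Cascade.lettersDefinable`).
-/

namespace LocalCascade

variable {P : Type u} {D : DistAlphabet P}

/-! ### Lower sets of events -/

instance Trace.finite_lowerSet (t : Trace D) : Finite (LowerSet t.Event) :=
  Finite.of_injective (fun c : LowerSet t.Event => (c : Set t.Event)) SetLike.coe_injective

/-- Induction on configurations: every lower set of a finite order arises from the empty one
by adding events one at a time. -/
theorem Trace.lowerSet_induction (t : Trace D) {p : LowerSet t.Event → Prop} (bot : p ⊥)
    (insert : ∀ (c c' : LowerSet t.Event) (e : t.Event), e ∉ c →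
      (c' : Set t.Event) = (c : Set t.Event) ∪ {e} → p c → p c')
    (c : LowerSet t.Event) : p c := by
  induction c using WellFoundedLT.induction with
  | ind c ih =>
    by_cases hc : (c : Set t.Event).Nonempty
    · obtain ⟨e, he⟩ := (Set.toFinite (c : Set t.Event)).exists_maximal hc
      have hlow : IsLowerSet ((c : Set t.Event) \ {e}) := by
        rintro a b hba ⟨ha, hae⟩
        refine ⟨c.lower hba ha, fun hbe => hae ?_⟩
        obtain rfl : b = e := hbe
        exact he.eq_of_ge ha hba
      let c₀ : LowerSet t.Event := ⟨_, hlow⟩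
      have hc₀ : e ∉ c₀ := fun h => h.2 rfl
      have heq : (c : Set t.Event) = (c₀ : Set t.Event) ∪ {e} := by
        change _ = ((c : Set t.Event) \ {e}) ∪ {e}
        rw [Set.sdiff_union_of_subset (Set.singleton_subset_iff.2 he.prop)]
      refine insert c₀ c e hc₀ heq (ih c₀ ?_)
      refine lt_of_le_of_ne (fun x hx => hx.1) fun h => hc₀ (h ▸ he.prop)
    · obtain rfl : c = ⊥ := by
        apply SetLike.coe_injective
        rw [Set.not_nonempty_iff_eq_empty.1 hc, LowerSet.coe_bot]
      exact bot

theorem Trace.lt_of_mem_of_notMem (t : Trace D) {i : P} {c : LowerSet t.Event} {e f : t.Event}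
    (he : e ∈ t.procEvents i) (hf : f ∈ t.procEvents i) (hfc : f ∈ c) (hec : e ∉ c) : f < e := by
  rcases t.le_or_le_of_dep f e ⟨i, hf, he⟩ with h | h
  · exact lt_of_le_of_ne h fun h' => hec (h' ▸ hfc)
  · exact absurd (c.lower h hfc) hec

/-! ### The run of an asynchronous automaton -/

namespace AsyncAutomaton

open Classical in
/-- The state of process `i` in the configuration `c` is the one produced by the last event of
`i` in `c`, and that event acts on the states of its own strict past. No linearization of the
trace is involved, so no confluence argument is needed. -/
noncomputable def run (A : AsyncAutomaton D) (t : Trace D) (c : LowerSet t.Event) (i : P) :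
    A.State i :=
  if h : ∃ f, Maximal (fun x => x ∈ c ∧ x ∈ t.procEvents i) f then
    A.step (t.label h.choose) (fun j => run A t (LowerSet.Iio h.choose) j)
      ⟨i, h.choose_spec.prop.2⟩
  else A.init i
termination_by (c : Set t.Event).ncard
decreasing_by
  have hf := h.choose_spec.prop.1
  refine Set.ncard_lt_ncard ⟨fun x hx => c.lower (le_of_lt hx) hf, fun hle => ?_⟩
    (Set.toFinite _)
  exact lt_irrefl _ (LowerSet.mem_Iio_iff.1 (hle hf))

theorem run_of_maximal (A : AsyncAutomaton D) (t : Trace D) {c : LowerSet t.Event} {i : P}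
    {e : t.Event} (he : Maximal (fun x => x ∈ c ∧ x ∈ t.procEvents i) e) :
    A.run t c i =
      A.step (t.label e) (fun j => A.run t (LowerSet.Iio e) j) ⟨i, he.prop.2⟩ := by
  have h : ∃ f, Maximal (fun x => x ∈ c ∧ x ∈ t.procEvents i) f := ⟨e, he⟩
  rw [run, dif_pos h]
  have key : ∀ f, ∀ hf : Maximal (fun x => x ∈ c ∧ x ∈ t.procEvents i) f, f = e →
      A.step (t.label f) (fun j => A.run t (LowerSet.Iio f) j) ⟨i, hf.prop.2⟩ =
      A.step (t.label e) (fun j => A.run t (LowerSet.Iio e) j) ⟨i, he.prop.2⟩ := by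
    rintro f hf rfl; rfl
  refine key _ h.choose_spec ?_
  have hm := h.choose_spec
  rcases t.le_or_le_of_dep h.choose e ⟨i, hm.prop.2, he.prop.2⟩ with hle | hle
  · exact hm.eq_of_le he.prop hle
  · exact (he.eq_of_le hm.prop hle).symm

theorem run_of_not_exists (A : AsyncAutomaton D) (t : Trace D) {c : LowerSet t.Event} {i : P}
    (h : ¬ ∃ f, Maximal (fun x => x ∈ c ∧ x ∈ t.procEvents i) f) : A.run t c i = A.init i := by
  rw [run, dif_neg h]

/-- The state of process `i` depends only on the events of `i` in the configuration. -/
theorem run_congr (A : AsyncAutomaton D) (t : Trace D) {c c' : LowerSet t.Event} {i : P}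
    (h : ∀ x ∈ t.procEvents i, x ∈ c ↔ x ∈ c') : A.run t c i = A.run t c' i := by
  have hp : (fun x => x ∈ c ∧ x ∈ t.procEvents i) = fun x => x ∈ c' ∧ x ∈ t.procEvents i := by
    funext x
    exact propext ⟨fun hx => ⟨(h x hx.2).1 hx.1, hx.2⟩, fun hx => ⟨(h x hx.2).2 hx.1, hx.2⟩⟩
  by_cases hf : ∃ f, Maximal (fun x => x ∈ c ∧ x ∈ t.procEvents i) f
  · obtain ⟨f, hf⟩ := hf
    rw [run_of_maximal A t hf, run_of_maximal A t (hp ▸ hf)]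
  · rw [run_of_not_exists A t hf, run_of_not_exists A t (hp ▸ hf)]

/-- Before an event `e`, the processes of `e` are in the states they have in the strict past
of `e`, whatever the configuration in which `e` occurs. -/
theorem run_eq_run_Iio (A : AsyncAutomaton D) (t : Trace D) {c c' : LowerSet t.Event}
    {e : t.Event} (hec : e ∉ c) (hc : (c' : Set t.Event) = (c : Set t.Event) ∪ {e}) {i : P}
    (hi : e ∈ t.procEvents i) : A.run t c i = A.run t (LowerSet.Iio e) i := by
  refine run_congr A t fun x hx => ⟨fun hxc => ?_, fun hxe => ?_⟩
  · exact LowerSet.mem_Iio_iff.2 (t.lt_of_mem_of_notMem hi hx hxc hec)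
  · have hxe := LowerSet.mem_Iio_iff.1 hxe
    have hec' : e ∈ (c' : Set t.Event) := hc ▸ Or.inr rfl
    have hx' : x ∈ (c' : Set t.Event) := c'.lower hxe.le hec'
    rw [hc] at hx'
    exact hx'.resolve_right hxe.ne

theorem globalStep_of_notMem (A : AsyncAutomaton D) {a : D.Letter} {i : P} (hi : i ∉ D.loc a)
    (s : A.Global) : A.globalStep a s i = s i :=
  dif_neg hi

theorem isRun_run (A : AsyncAutomaton D) (t : Trace D) : A.IsRun t (A.run t) where
  init := by
    funext i
    exact run_of_not_exists A t fun ⟨f, hf⟩ => LowerSet.notMem_bot hf.prop.1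
  step c c' e hec hc := by
    have hmem : ∀ x, x ∈ c' ↔ x ∈ c ∨ x = e := fun x => by
      rw [← SetLike.mem_coe, hc]; rfl
    funext i
    by_cases hi : i ∈ D.loc (t.label e)
    · have hmax : Maximal (fun x => x ∈ c' ∧ x ∈ t.procEvents i) e := by
        refine ⟨⟨(hmem e).2 (Or.inr rfl), hi⟩, fun x hx hle => ?_⟩
        rcases (hmem x).1 hx.1 with h | h
        · exact absurd (c.lower hle h) hec
        · exact h.le
      rw [run_of_maximal A t hmax, globalStep, dif_pos hi]
      congr 1
      funext j
      exact run_eq_run_Iio A t hec hc j.2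
    · rw [globalStep, dif_neg hi]
      refine run_congr A t fun x hx => ⟨fun h => (hmem x).2 (Or.inl h), fun h => ?_⟩
      refine ((hmem x).1 h).resolve_right ?_
      rintro rfl
      exact hi hx

theorem IsRun.eq_run {A : AsyncAutomaton D} {t : Trace D} {ρ : LowerSet t.Event → A.Global}
    (h : A.IsRun t ρ) : ρ = A.run t := by
  funext c
  induction c using t.lowerSet_induction with
  | bot => rw [h.init, (A.isRun_run t).init]
  | insert c c' e hec hc ih =>
    rw [← h.step c c' e hec hc, ← (A.isRun_run t).step c c' e hec hc, ih]

theorem accepts_iff {A : AsyncAutomaton D} {L : Set (Trace D)} :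
    A.Accepts L ↔ ∃ F : Set A.Global, ∀ t, t ∈ L ↔ A.run t ⊤ ∈ F := by
  refine exists_congr fun F => ?_
  rw [Set.ext_iff]
  refine forall_congr' fun t => iff_congr Iff.rfl ⟨?_, fun h => ⟨_, A.isRun_run t, h⟩⟩
  rintro ⟨ρ, hρ, h⟩
  exact hρ.eq_run ▸ h

/-! ### Runs of cascade products -/

variable [Finite P]

/-- The letter of `D.extend A` at an event: its label with the states in which `A` reads it. -/
noncomputable def extLabel (A : AsyncAutomaton D) (t : Trace D) (e : t.Event) :
    (D.extend A).Letter :=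
  ⟨t.label e, fun j => A.run t (LowerSet.Iio e) j⟩

/-- The trace `t` relabelled by the run of `A`; it has the same events and the same order. -/
noncomputable abbrev _root_.LocalCascade.Trace.extend (t : Trace D) (A : AsyncAutomaton D) :
    Trace (D.extend A) where
  Event := t.Event
  label := A.extLabel t
  dep_of_covBy := t.dep_of_covBy
  le_or_le_of_dep := t.le_or_le_of_dep

theorem cascade_run (A : AsyncAutomaton D) (B : AsyncAutomaton (D.extend A)) (t : Trace D)
    (c : LowerSet t.Event) (i : P) :
    (A.cascade B).run t c i = (A.run t c i, B.run (t.extend A) c i) := by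
  have h : (A.cascade B).IsRun t fun c i => (A.run t c i, B.run (t.extend A) c i) := by
    refine ⟨?_, fun c c' e hec hc => ?_⟩
    · funext i
      exact Prod.ext (congrFun (A.isRun_run t).init i)
        (congrFun (B.isRun_run (t.extend A)).init i)
    · have hA := (A.isRun_run t).step c c' e hec hc
      have hB := (B.isRun_run (t.extend A)).step c c' e hec hc
      funext i
      have hAi := congrFun hA i
      have hBi := congrFun hB i
      rw [← hAi, ← hBi]
      by_cases hi : i ∈ D.loc (t.label e)
      · have hi' : i ∈ (D.extend A).loc ((t.extend A).label e) := hi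
        -- `B` reads the states of `A` in the strict past of `e`, not those in `c`.
        have hs : (fun j : D.loc (t.label e) => A.run t c j) =
            fun j : D.loc (t.label e) => A.run t (LowerSet.Iio e) j :=
          funext fun j => run_eq_run_Iio A t hec hc j.2
        simp only [globalStep, dif_pos hi, dif_pos hi', cascade]
        refine Prod.ext rfl ?_
        dsimp only
        rw [hs]
        rfl
      · have hi' : i ∉ (D.extend A).loc ((t.extend A).label e) := hi
        refine (dif_neg hi).trans (Prod.ext ?_ ?_)
        · exact (A.globalStep_of_notMem hi _).symm
        · exact (B.globalStep_of_notMem hi' _).symm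
  rw [← h.eq_run]

end AsyncAutomaton

/-! ### The since modality on configurations -/

/-- The configuration `c` satisfies `φ S_i φ'` if some event of process `i` in `c` satisfies
`φ'` and all later events of `i` in `c` satisfy `φ`. -/
def Trace.SinceOn (t : Trace D) (i : P) (φ φ' : t.Event → Prop) (c : LowerSet t.Event) : Prop :=
  ∃ f ∈ t.procEvents i, f ∈ c ∧ φ' f ∧ ∀ g ∈ t.procEvents i, g ∈ c → f < g → φ g

theorem Trace.not_sinceOn_bot (t : Trace D) (i : P) (φ φ' : t.Event → Prop) :
    ¬ t.SinceOn i φ φ' ⊥ := fun ⟨_, _, h, _⟩ => LowerSet.notMem_bot h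

theorem Trace.sinceOn_insert (t : Trace D) (i : P) (φ φ' : t.Event → Prop)
    {c c' : LowerSet t.Event} {e : t.Event} (hec : e ∉ c)
    (hc : (c' : Set t.Event) = (c : Set t.Event) ∪ {e}) :
    t.SinceOn i φ φ' c' ↔ (e ∈ t.procEvents i ∧ φ' e) ∨
      ((e ∈ t.procEvents i → φ e) ∧ t.SinceOn i φ φ' c) := by
  have hmem : ∀ x, x ∈ c' ↔ x ∈ c ∨ x = e := fun x => by rw [← SetLike.mem_coe, hc]; rfl
  constructor
  · rintro ⟨f, hf, hfc, hf', h⟩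
    rcases (hmem f).1 hfc with hfc | rfl
    · refine Or.inr ⟨fun he => ?_, f, hf, hfc, hf', fun g hg hgc => ?_⟩
      · exact h e he ((hmem e).2 (Or.inr rfl)) (t.lt_of_mem_of_notMem he hf hfc hec)
      · exact h g hg ((hmem g).2 (Or.inl hgc))
    · exact Or.inl ⟨hf, hf'⟩
  · rintro (⟨he, he'⟩ | ⟨he, f, hf, hfc, hf', h⟩)
    · refine ⟨e, he, (hmem e).2 (Or.inr rfl), he', fun g _ hgc hlt => ?_⟩
      rcases (hmem g).1 hgc with hgc | rfl
      · exact absurd (c.lower hlt.le hgc) hec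
      · exact absurd hlt (lt_irrefl _)
    · refine ⟨f, hf, (hmem f).2 (Or.inl hfc), hf', fun g hg hgc hlt => ?_⟩
      rcases (hmem g).1 hgc with hgc | rfl
      · exact h g hg hgc hlt
      · exact he hg

theorem EventFormula.holds_since_iff {t : Trace D} {i : P} {α α' : EventFormula D}
    {e : t.Event} : (EventFormula.since i α α').Holds t e ↔
      e ∈ t.procEvents i ∧ t.SinceOn i (α.Holds t) (α'.Holds t) (LowerSet.Iio e) := by
  constructor
  · rintro ⟨he, f, hf, hlt, hf', h⟩
    exact ⟨he, f, hf, LowerSet.mem_Iio_iff.2 hlt, hf', fun g hg hge hfg =>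
      h g hg hfg (LowerSet.mem_Iio_iff.1 hge)⟩
  · rintro ⟨he, f, hf, hlt, hf', h⟩
    exact ⟨he, f, hf, LowerSet.mem_Iio_iff.1 hlt, hf', fun g hg hfg hge =>
      h g hg (LowerSet.mem_Iio_iff.2 hge) hfg⟩

/-! ### A reset automaton computing a since modality -/

open Classical in
/-- The `U₂[i]` automaton whose process `i` remembers whether `X S_i X'` holds: letters of `X'`
set the bit, letters in neither `X` nor `X'` clear it. The processes other than `i` carry the
constant bit `false`. -/
noncomputable def sinceAutomaton (D : DistAlphabet P) (i : P) (X X' : Set D.Letter) :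
    AsyncAutomaton D where
  State j := {b : Bool // j ≠ i → b = false}
  finite_state _ := inferInstance
  step a s j := ⟨if (j : P) = i then
      (if a ∈ X' then true else if a ∈ X then (s j).1 else false) else false,
    fun h => if_neg h⟩
  init _ := ⟨false, fun _ => rfl⟩

theorem sinceAutomaton_globalStep (i : P) (X X' : Set D.Letter) (a : D.Letter)
    (s : (sinceAutomaton D i X X').Global) :
    ((sinceAutomaton D i X X').globalStep a s i).1 = true ↔
      (a ∈ D.sub i ∧ a ∈ X') ∨ ((a ∈ D.sub i → a ∈ X) ∧ (s i).1 = true) := by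
  by_cases hi : a ∈ D.sub i
  · simp only [AsyncAutomaton.globalStep, sinceAutomaton, if_true]
    by_cases h' : a ∈ X' <;> by_cases h : a ∈ X <;> simp [hi, h, h']
  · simp [AsyncAutomaton.globalStep, hi]

theorem sinceAutomaton_isU2 (D : DistAlphabet P) (i : P) (X X' : Set D.Letter) :
    (sinceAutomaton D i X X').IsU2 i := by
  have hext : ∀ {j : P} (p q : (sinceAutomaton D i X X').State j), p.1 = q.1 → p = q :=
    fun p q h => Subtype.ext h
  have hcard : ∀ j, j ≠ i → ∀ p q : (sinceAutomaton D i X X').State j, p = q :=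
    fun j hj p q => hext p q ((p.2 hj).trans (q.2 hj).symm)
  refine ⟨fun j hj => ?_, ⟨true, fun h => absurd rfl h⟩, ⟨false, fun _ => rfl⟩,
    {a | a ∈ D.sub i ∧ a ∈ X'}, {a | a ∈ D.sub i ∧ a ∉ X' ∧ a ∉ X}, ?_, ?_,
    fun a h => h.1, fun a h => h.1, ?_, ?_, ?_, ?_⟩
  · have : Subsingleton ((sinceAutomaton D i X X').State j) := ⟨hcard j hj⟩
    have : Nonempty ((sinceAutomaton D i X X').State j) := ⟨(sinceAutomaton D i X X').init j⟩
    exact Nat.card_eq_one_iff_unique.2 ⟨inferInstance, inferInstance⟩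
  · intro h
    simpa using congrArg Subtype.val h
  · rintro ⟨b, hb⟩
    cases b
    · exact Or.inr rfl
    · exact Or.inl rfl
  · exact Set.disjoint_left.2 fun a h h' => h'.2.1 h.2
  · intro a ha s
    exact hext _ _ ((sinceAutomaton_globalStep i X X' a s).2 (Or.inl ha))
  · intro a ha s
    refine hext _ _ (Bool.eq_false_iff.2 fun h => ?_)
    rcases (sinceAutomaton_globalStep i X X' a s).1 h with h | h
    · exact ha.2.1 h.2
    · exact ha.2.2 (h.1 ha.1)
  · intro a h₁ h₂ s
    funext j
    by_cases hj : j = i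
    · subst hj
      refine hext _ _ (Bool.eq_iff_iff.2 ((sinceAutomaton_globalStep j X X' a s).trans ?_))
      simp only [Set.mem_ofPred_eq] at h₁ h₂
      tauto
    · exact hcard j hj _ _

theorem sinceAutomaton_run (i : P) (X X' : Set D.Letter) (t : Trace D) (c : LowerSet t.Event) :
    ((sinceAutomaton D i X X').run t c i).1 = true ↔
      t.SinceOn i (fun e => t.label e ∈ X) (fun e => t.label e ∈ X') c := by
  have hrun := (sinceAutomaton D i X X').isRun_run t
  induction c using t.lowerSet_induction with
  | bot =>
    rw [hrun.init]
    exact iff_of_false Bool.false_ne_true (t.not_sinceOn_bot i _ _)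
  | insert c c' e hec hc ih =>
    rw [← hrun.step c c' e hec hc]
    exact (sinceAutomaton_globalStep i X X' _ _).trans
      ((or_congr Iff.rfl (and_congr Iff.rfl ih)).trans (t.sinceOn_insert i
        (fun e => t.label e ∈ X) (fun e => t.label e ∈ X') hec hc).symm)

/-! ### From formulas to cascade products -/

section

variable [Finite P]

/-- The property `φ` of events of traces can be read off the letters of `D.extend A`. -/
def AsyncAutomaton.Computes (A : AsyncAutomaton D) (φ : ∀ t : Trace D, t.Event → Prop) : Prop :=
  ∃ X : Set (D.extend A).Letter, ∀ t e, φ t e ↔ A.extLabel t e ∈ X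

/-- `A'` carries at least the information that `A` does. -/
structure AsyncAutomaton.Refines (A' A : AsyncAutomaton D) : Prop where
  computes : ∀ φ, A.Computes φ → A'.Computes φ
  accepts : ∀ L, A.Accepts L → A'.Accepts L

theorem AsyncAutomaton.Refines.refl (A : AsyncAutomaton D) : A.Refines A :=
  ⟨fun _ h => h, fun _ h => h⟩

theorem AsyncAutomaton.Refines.trans {A A' A'' : AsyncAutomaton D} (h : A''.Refines A')
    (h' : A'.Refines A) : A''.Refines A :=
  ⟨fun φ hφ => h.computes φ (h'.computes φ hφ), fun L hL => h.accepts L (h'.accepts L hL)⟩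

theorem AsyncAutomaton.cascade_refines (A : AsyncAutomaton D) (B : AsyncAutomaton (D.extend A)) :
    (A.cascade B).Refines A := by
  refine ⟨?_, fun L hL => ?_⟩
  · rintro φ ⟨X, hX⟩
    refine ⟨{x | (⟨x.1, fun j => (x.2 j).1⟩ : (D.extend A).Letter) ∈ X}, fun t e => ?_⟩
    have h : A.extLabel t e =
        ⟨t.label e, fun j => ((A.cascade B).run t (LowerSet.Iio e) j).1⟩ :=
      congrArg (Sigma.mk _) (funext fun j => (congrArg Prod.fst (cascade_run A B t _ j)).symm)
    rw [hX t e, h]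
    rfl
  · obtain ⟨F, hF⟩ := accepts_iff.1 hL
    refine accepts_iff.2 ⟨{s | (fun i => (s i).1) ∈ F}, fun t => ?_⟩
    rw [hF t]
    simp [cascade_run]

/-- The state of process `i` in the second factor, for the automaton of a since modality. -/
theorem AsyncAutomaton.cascade_sinceAutomaton_run (A : AsyncAutomaton D) (i : P)
    (X X' : Set (D.extend A).Letter) (t : Trace D) (c : LowerSet t.Event) :
    ((A.cascade (sinceAutomaton (D.extend A) i X X')).run t c i).2.1 = true ↔
      t.SinceOn i (fun e => A.extLabel t e ∈ X) (fun e => A.extLabel t e ∈ X') c := by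
  rw [cascade_run]
  exact sinceAutomaton_run i X X' (t.extend A) c

theorem IsU2Cascade.cascade_sinceAutomaton {A : AsyncAutomaton D} (hA : IsU2Cascade D A) (i : P)
    (X X' : Set (D.extend A).Letter) :
    IsU2Cascade D (A.cascade (sinceAutomaton (D.extend A) i X X')) :=
  .cascade D A _ hA (.single _ _ i (sinceAutomaton_isU2 _ i X X'))

theorem EventFormula.exists_cascade_computes (α : EventFormula D) (hα : α.YFree)
    (A : AsyncAutomaton D) (hA : IsU2Cascade D A) :
    ∃ A', IsU2Cascade D A' ∧ A'.Refines A ∧ A'.Computes fun t e => α.Holds t e := by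
  induction α generalizing A with
  | letter a => exact ⟨A, hA, .refl A, {x | x.1 = a}, fun t e => Iff.rfl⟩
  | neg α ih =>
    obtain ⟨A', hA', href, X, hX⟩ := ih hα A hA
    exact ⟨A', hA', href, Xᶜ, fun t e => not_congr (hX t e)⟩
  | or α α' ih ih' =>
    obtain ⟨A₁, hA₁, href₁, hX⟩ := ih hα.1 A hA
    obtain ⟨A₂, hA₂, href₂, X', hX'⟩ := ih' hα.2 A₁ hA₁
    obtain ⟨X, hX⟩ := href₂.computes _ hX
    exact ⟨A₂, hA₂, href₂.trans href₁, X ∪ X', fun t e => or_congr (hX t e) (hX' t e)⟩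
  | yesterday i α ih => exact hα.elim
  | since i α α' ih ih' =>
    obtain ⟨A₁, hA₁, href₁, hX⟩ := ih hα.1 A hA
    obtain ⟨A₂, hA₂, href₂, X', hX'⟩ := ih' hα.2 A₁ hA₁
    obtain ⟨X, hX⟩ := href₂.computes _ hX
    refine ⟨_, hA₂.cascade_sinceAutomaton i X X',
      (A₂.cascade_refines _).trans (href₂.trans href₁),
      {x | ∃ h : i ∈ D.loc x.1, (x.2 ⟨i, h⟩).2.1 = true}, fun t e => ?_⟩
    have hα₁ : α.Holds t = fun e => A₂.extLabel t e ∈ X := funext fun e => propext (hX t e)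
    have hα₂ : α'.Holds t = fun e => A₂.extLabel t e ∈ X' := funext fun e => propext (hX' t e)
    refine EventFormula.holds_since_iff.trans ?_
    rw [hα₁, hα₂, ← A₂.cascade_sinceAutomaton_run i X X']
    exact exists_prop.symm

theorem TraceFormula.exists_cascade_accepts (β : TraceFormula D) (hβ : β.YFree)
    (A : AsyncAutomaton D) (hA : IsU2Cascade D A) :
    ∃ A', IsU2Cascade D A' ∧ A'.Refines A ∧ A'.Accepts β.language := by
  induction β generalizing A with
  | ex i α =>
    obtain ⟨A', hA', href, X, hX⟩ := α.exists_cascade_computes hβ A hA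
    -- The last event of `i` satisfies `α` iff the complete trace satisfies `⊥ S_i α`.
    refine ⟨_, hA'.cascade_sinceAutomaton i ∅ X, (A'.cascade_refines _).trans href,
      AsyncAutomaton.accepts_iff.2 ⟨{s | (s i).2.1 = true}, fun t => ?_⟩⟩
    refine Iff.trans ?_ (A'.cascade_sinceAutomaton_run i ∅ X t ⊤).symm
    constructor
    · rintro ⟨e, he, hα⟩
      refine ⟨e, he.prop, LowerSet.mem_top, (hX t e).1 hα, fun g hg _ hlt => ?_⟩
      exact absurd (he.le_of_ge hg hlt.le) (not_le_of_gt hlt)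
    · rintro ⟨e, he, -, hα, h⟩
      refine ⟨e, ⟨he, fun g hg hle => ?_⟩, (hX t e).2 hα⟩
      by_contra hge
      exact h g hg LowerSet.mem_top (lt_of_le_not_ge hle hge)
  | neg β ih =>
    obtain ⟨A', hA', href, hF⟩ := ih hβ A hA
    obtain ⟨F, hF⟩ := AsyncAutomaton.accepts_iff.1 hF
    exact ⟨A', hA', href, AsyncAutomaton.accepts_iff.2 ⟨Fᶜ, fun t => not_congr (hF t)⟩⟩
  | or β β' ih ih' =>
    obtain ⟨A₁, hA₁, href₁, hF⟩ := ih hβ.1 A hA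
    obtain ⟨A₂, hA₂, href₂, hF'⟩ := ih' hβ.2 A₁ hA₁
    obtain ⟨F, hF⟩ := AsyncAutomaton.accepts_iff.1 (href₂.accepts _ hF)
    obtain ⟨F', hF'⟩ := AsyncAutomaton.accepts_iff.1 hF'
    exact ⟨A₂, hA₂, href₂.trans href₁,
      AsyncAutomaton.accepts_iff.2 ⟨F ∪ F', fun t => or_congr (hF t) (hF' t)⟩⟩

end

/-! ### Definable properties of events and traces -/

/-- A property of events of traces that is expressed by a formula without `Y_i`. -/
def EventDefinable (φ : ∀ t : Trace D, t.Event → Prop) : Prop :=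
  ∃ α : EventFormula D, α.YFree ∧ ∀ t e, α.Holds t e ↔ φ t e

/-- A property of traces that is expressed by a formula without `Y_i`. -/
def TraceDefinable (φ : Trace D → Prop) : Prop :=
  ∃ β : TraceFormula D, β.YFree ∧ ∀ t, β.Holds t ↔ φ t

namespace EventDefinable

variable {φ φ' : ∀ t : Trace D, t.Event → Prop}

theorem letter (a : D.Letter) : EventDefinable fun (t : Trace D) e => t.label e = a :=
  ⟨.letter a, trivial, fun _ _ => Iff.rfl⟩

theorem not (h : EventDefinable φ) : EventDefinable fun t e => ¬ φ t e :=
  let ⟨α, hα, h⟩ := h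
  ⟨.neg α, hα, fun t e => not_congr (h t e)⟩

theorem or (h : EventDefinable φ) (h' : EventDefinable φ') :
    EventDefinable fun t e => φ t e ∨ φ' t e :=
  let ⟨α, hα, h⟩ := h
  let ⟨α', hα', h'⟩ := h'
  ⟨.or α α', ⟨hα, hα'⟩, fun t e => or_congr (h t e) (h' t e)⟩

theorem congr (h : EventDefinable φ) (hφ : ∀ t e, φ t e ↔ φ' t e) : EventDefinable φ' :=
  let ⟨α, hα, h⟩ := h
  ⟨α, hα, fun t e => (h t e).trans (hφ t e)⟩

theorem and (h : EventDefinable φ) (h' : EventDefinable φ') :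
    EventDefinable fun t e => φ t e ∧ φ' t e :=
  (h.not.or h'.not).not.congr fun t e => by tauto

theorem const [Nonempty D.Letter] (p : Prop) :
    EventDefinable fun (t : Trace D) (_ : t.Event) => p := by
  have h := letter (Classical.arbitrary D.Letter)
  by_cases hp : p
  · exact (h.or h.not).congr fun t e => by tauto
  · exact (h.and h.not).congr fun t e => by tauto

theorem since (i : P) (h : EventDefinable φ) (h' : EventDefinable φ') :
    EventDefinable fun t e =>
      e ∈ t.procEvents i ∧ t.SinceOn i (φ t) (φ' t) (LowerSet.Iio e) := by
  obtain ⟨α, hα, h⟩ := h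
  obtain ⟨α', hα', h'⟩ := h'
  refine ⟨.since i α α', ⟨hα, hα'⟩, fun t e => ?_⟩
  have e₁ : α.Holds t = φ t := funext fun e => propext (h t e)
  have e₂ : α'.Holds t = φ' t := funext fun e => propext (h' t e)
  rw [EventFormula.holds_since_iff, e₁, e₂]

theorem exists_mem [Nonempty D.Letter] {ι : Type*} {s : Set ι} (hs : s.Finite)
    {ψ : ι → ∀ t : Trace D, t.Event → Prop} (h : ∀ x ∈ s, EventDefinable (ψ x)) :
    EventDefinable fun t e => ∃ x ∈ s, ψ x t e := by
  induction s, hs using Set.Finite.induction_on with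
  | empty => exact (const False).congr fun t e => by simp
  | insert _ _ ih =>
    exact ((h _ (Set.mem_insert _ _)).or
      (ih fun x hx => h x (Set.mem_insert_of_mem _ hx))).congr fun t e => by simp

theorem label_mem [Nonempty D.Letter] (X : Set D.Letter) :
    EventDefinable fun (t : Trace D) e => t.label e ∈ X := by
  have := D.finite_letter
  exact (exists_mem (Set.toFinite X) fun a _ => letter a).congr fun t e => by simp

end EventDefinable

namespace TraceDefinable

variable {φ φ' : Trace D → Prop}

theorem not (h : TraceDefinable φ) : TraceDefinable fun t => ¬ φ t :=
  let ⟨β, hβ, h⟩ := h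
  ⟨.neg β, hβ, fun t => not_congr (h t)⟩

theorem or (h : TraceDefinable φ) (h' : TraceDefinable φ') :
    TraceDefinable fun t => φ t ∨ φ' t :=
  let ⟨β, hβ, h⟩ := h
  let ⟨β', hβ', h'⟩ := h'
  ⟨.or β β', ⟨hβ, hβ'⟩, fun t => or_congr (h t) (h' t)⟩

theorem congr (h : TraceDefinable φ) (hφ : ∀ t, φ t ↔ φ' t) : TraceDefinable φ' :=
  let ⟨β, hβ, h⟩ := h
  ⟨β, hβ, fun t => (h t).trans (hφ t)⟩

theorem and (h : TraceDefinable φ) (h' : TraceDefinable φ') :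
    TraceDefinable fun t => φ t ∧ φ' t :=
  (h.not.or h'.not).not.congr fun t => by tauto

theorem ex (i : P) {ψ : ∀ t : Trace D, t.Event → Prop} (h : EventDefinable ψ) :
    TraceDefinable fun t => ∃ e, Maximal (fun x => x ∈ t.procEvents i) e ∧ ψ t e :=
  let ⟨α, hα, h⟩ := h
  ⟨.ex i α, hα, fun t => exists_congr fun e => and_congr Iff.rfl (h t e)⟩

theorem const [Nonempty D.Letter] (p : Prop) : TraceDefinable fun _ : Trace D => p := by
  obtain ⟨i, -⟩ := D.exists_mem_sub (Classical.arbitrary D.Letter)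
  have h := ex i (EventDefinable.const (D := D) True)
  by_cases hp : p
  · exact (h.or h.not).congr fun t => iff_of_true (Classical.em _) hp
  · exact (h.and h.not).congr fun t => iff_of_false (fun h => h.2 h.1) hp

theorem exists_mem [Nonempty D.Letter] {ι : Type*} {s : Set ι} (hs : s.Finite)
    {ψ : ι → Trace D → Prop} (h : ∀ x ∈ s, TraceDefinable (ψ x)) :
    TraceDefinable fun t => ∃ x ∈ s, ψ x t := by
  induction s, hs using Set.Finite.induction_on with
  | empty => exact (const False).congr fun t => by simp
  | insert _ _ ih =>
    exact ((h _ (Set.mem_insert _ _)).or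
      (ih fun x hx => h x (Set.mem_insert_of_mem _ hx))).congr fun t => by simp

theorem forall_of_finite [Nonempty D.Letter] {ι : Type*} [Finite ι] {ψ : ι → Trace D → Prop}
    (h : ∀ x, TraceDefinable (ψ x)) : TraceDefinable fun t => ∀ x, ψ x t :=
  (exists_mem (Set.toFinite Set.univ) fun x _ => (h x).not).not.congr fun t => by simp

end TraceDefinable

/-! ### From cascade products to formulas -/

/-- The state of process `ℓ` in a reset automaton is `q₁` iff the last reset was to `q₁`, or
there was no reset and the initial state is `q₁`. -/
theorem AsyncAutomaton.run_eq_iff_of_reset {A : AsyncAutomaton D} {ℓ : P} {q₁ q₂ : A.State ℓ}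
    {R₁ R₂ : Set D.Letter} (hne : q₁ ≠ q₂) (hR₁ : R₁ ⊆ D.sub ℓ) (hR₂ : R₂ ⊆ D.sub ℓ)
    (h₁ : ∀ a ∈ R₁, ∀ s, A.globalStep a s ℓ = q₁)
    (h₂ : ∀ a ∈ R₂, ∀ s, A.globalStep a s ℓ = q₂)
    (h₀ : ∀ a, a ∉ R₁ → a ∉ R₂ → ∀ s, A.globalStep a s = s) (t : Trace D)
    (c : LowerSet t.Event) :
    A.run t c ℓ = q₁ ↔
      t.SinceOn ℓ (fun e => t.label e ∉ R₂) (fun e => t.label e ∈ R₁) c ∨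
      (A.init ℓ = q₁ ∧ ¬ t.SinceOn ℓ (fun _ => True) (fun e => t.label e ∈ R₁ ∪ R₂) c) := by
  have hrun := A.isRun_run t
  induction c using t.lowerSet_induction with
  | bot =>
    rw [hrun.init]
    have h := t.not_sinceOn_bot ℓ
    simp [h]
  | insert c c' e hec hc ih =>
    rw [← hrun.step c c' e hec hc, t.sinceOn_insert ℓ _ _ hec hc, t.sinceOn_insert ℓ _ _ hec hc]
    by_cases he₁ : t.label e ∈ R₁
    · have : e ∈ t.procEvents ℓ := hR₁ he₁
      simp [h₁ _ he₁, this, he₁]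
    · by_cases he₂ : t.label e ∈ R₂
      · have : e ∈ t.procEvents ℓ := hR₂ he₂
        simp [h₂ _ he₂, this, he₁, he₂, hne.symm]
      · rw [h₀ _ he₁ he₂]
        refine ih.trans ?_
        simp [he₁, he₂]

variable [Finite P]

/-- Every set of letters of `D.extend A` is definable over `D`. -/
def AsyncAutomaton.LettersDefinable (A : AsyncAutomaton D) : Prop :=
  ∀ X : Set (D.extend A).Letter, EventDefinable fun t e => A.extLabel t e ∈ X

theorem AsyncAutomaton.IsU2.lettersDefinable [Nonempty D.Letter] {ℓ : P} {A : AsyncAutomaton D}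
    (hA : A.IsU2 ℓ) : A.LettersDefinable := by
  classical
  obtain ⟨hcard, q₁, q₂, R₁, R₂, hne, hq, hR₁, hR₂, -, h₁, h₂, h₀⟩ := hA
  intro X
  have hψ := ((EventDefinable.label_mem R₂).not.since ℓ (EventDefinable.label_mem R₁)).or
    ((EventDefinable.const (A.init ℓ = q₁)).and
      ((EventDefinable.const True).since ℓ (EventDefinable.label_mem (R₁ ∪ R₂))).not)
  -- The global state is determined by the state of `ℓ`.
  let σ (q : A.State ℓ) : A.Global := Function.update A.init ℓ q
  have hσ : ∀ s : A.Global, s = σ (s ℓ) := by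
    intro s
    funext j
    by_cases hj : j = ℓ
    · subst hj
      exact (Function.update_self j (s j) A.init).symm
    · have := (Nat.card_eq_one_iff_unique.1 (hcard j hj)).1
      exact Subsingleton.elim _ _
  let Y (q : A.State ℓ) : Set D.Letter :=
    {a | (⟨a, fun j => σ q j⟩ : (D.extend A).Letter) ∈ X}
  refine ((hψ.and (EventDefinable.label_mem (Y q₁))).or
    (hψ.not.and (EventDefinable.label_mem (Y q₂)))).congr fun t e => ?_
  have hX : A.extLabel t e ∈ X ↔ t.label e ∈ Y (A.run t (LowerSet.Iio e) ℓ) := by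
    change _ ↔ (⟨t.label e, fun j => σ _ j⟩ : (D.extend A).Letter) ∈ X
    rw [← hσ]
    rfl
  by_cases he : e ∈ t.procEvents ℓ
  · have hrun := run_eq_iff_of_reset hne hR₁ hR₂ h₁ h₂ h₀ t (LowerSet.Iio e)
    simp only [he, true_and, ← hrun, hX]
    rcases hq (A.run t (LowerSet.Iio e) ℓ) with h | h <;> simp [h, hne.symm]
  · -- If `e` is not an event of `ℓ`, its letter does not mention the state of `ℓ`.
    have hY : ∀ q q', t.label e ∈ Y q ↔ t.label e ∈ Y q' := by
      intro q q'
      have : (fun j : D.loc (t.label e) => σ q j) = fun j : D.loc (t.label e) => σ q' j := by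
        funext j
        have hj : (j : P) ≠ ℓ := fun h => he (h ▸ j.2)
        exact (Function.update_of_ne hj _ _).trans (Function.update_of_ne hj _ _).symm
      change (⟨t.label e, fun j => σ q j⟩ : (D.extend A).Letter) ∈ X ↔ _
      rw [this]
      rfl
    rw [hX, hY q₂ q₁, hY (A.run t (LowerSet.Iio e) ℓ) q₁]
    tauto

/-- Formulas over `D.extend A` can be read over `D`: relabelling keeps the events of each
process and their order, so only the letters have to be replaced. -/
theorem AsyncAutomaton.LettersDefinable.eventDefinable_extend {A : AsyncAutomaton D}
    (hA : A.LettersDefinable) (α : EventFormula (D.extend A)) (hα : α.YFree) :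
    EventDefinable fun (t : Trace D) e => α.Holds (t.extend A) e := by
  induction α with
  | letter x => exact hA {x}
  | neg α ih => exact (ih hα).not
  | or α α' ih ih' => exact (ih hα.1).or (ih' hα.2)
  | yesterday i α ih => exact hα.elim
  | since i α α' ih ih' =>
    exact ((ih hα.1).since i (ih' hα.2)).congr fun t e =>
      (EventFormula.holds_since_iff (t := t.extend A)).symm

theorem AsyncAutomaton.LettersDefinable.cascade {A : AsyncAutomaton D}
    {B : AsyncAutomaton (D.extend A)} (hA : A.LettersDefinable) (hB : B.LettersDefinable) :
    (A.cascade B).LettersDefinable := by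
  intro X
  obtain ⟨α, hα, h⟩ := hB {y | (⟨y.1.1, fun j => (y.1.2 j, y.2 j)⟩ :
    (D.extend (A.cascade B)).Letter) ∈ X}
  refine (hA.eventDefinable_extend α hα).congr fun t e => (h (t.extend A) e).trans ?_
  have : (A.cascade B).extLabel t e = ⟨t.label e, fun j =>
      (A.run t (LowerSet.Iio e) j, B.run (t.extend A) (LowerSet.Iio e) j)⟩ :=
    congrArg (Sigma.mk _) (funext fun j => cascade_run A B t _ j)
  rw [this]
  rfl

theorem IsU2Cascade.lettersDefinable {D : DistAlphabet P} {A : AsyncAutomaton D}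
    (hA : IsU2Cascade D A) (hD : Nonempty D.Letter) : A.LettersDefinable := by
  induction hA with
  | single D A ℓ hA => exact hA.lettersDefinable
  | cascade D A B _ _ ihA ihB =>
    exact (ihA hD).cascade (ihB (hD.map fun a => ⟨a, fun i => A.init i⟩))

theorem AsyncAutomaton.LettersDefinable.traceDefinable_run_top [Nonempty D.Letter]
    {A : AsyncAutomaton D} (hA : A.LettersDefinable) (i : P) (q : A.State i) :
    TraceDefinable fun t => A.run t ⊤ i = q := by
  have hlast := TraceDefinable.ex i
    (hA {x | ∃ h : i ∈ D.loc x.1, A.step x.1 x.2 ⟨i, h⟩ = q})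
  have hany := TraceDefinable.ex i (EventDefinable.const (D := D) True)
  refine (hlast.or (hany.not.and (TraceDefinable.const (A.init i = q)))).congr fun t => ?_
  have hp : (fun x => x ∈ t.procEvents i) =
      fun x => x ∈ (⊤ : LowerSet t.Event) ∧ x ∈ t.procEvents i := by
    funext x
    exact propext ⟨fun h => ⟨LowerSet.mem_top, h⟩, fun h => h.2⟩
  rw [hp]
  by_cases h : ∃ e, Maximal (fun x => x ∈ (⊤ : LowerSet t.Event) ∧ x ∈ t.procEvents i) e
  · obtain ⟨e, he⟩ := h
    rw [A.run_of_maximal t he]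
    constructor
    · rintro (⟨f, hf, _, hq⟩ | ⟨h, -⟩)
      · rw [← A.run_of_maximal t he, A.run_of_maximal t hf]
        exact hq
      · exact absurd ⟨e, he, trivial⟩ h
    · exact fun hq => Or.inl ⟨e, he, he.prop.2, hq⟩
  · rw [A.run_of_not_exists t h]
    constructor
    · rintro (⟨f, hf, -⟩ | ⟨-, hq⟩)
      · exact absurd ⟨f, hf⟩ h
      · exact hq
    · exact fun hq => Or.inr ⟨fun ⟨f, hf, _⟩ => h ⟨f, hf⟩, hq⟩

theorem AsyncAutomaton.LettersDefinable.traceDefinable_of_accepts [Nonempty D.Letter]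
    {A : AsyncAutomaton D} (hA : A.LettersDefinable) {L : Set (Trace D)} (hL : A.Accepts L) :
    TraceDefinable fun t => t ∈ L := by
  obtain ⟨F, hF⟩ := accepts_iff.1 hL
  have := A.finite_state
  refine (TraceDefinable.exists_mem (Set.toFinite F) fun s _ =>
    TraceDefinable.forall_of_finite fun i => hA.traceDefinable_run_top i (s i)).congr fun t => ?_
  rw [hF t]
  simp only [← funext_iff, exists_eq_right']

end LocalCascade

theorem mainTheorem5 {P : Type u} [Finite P] (D : LocalCascade.DistAlphabet P)
    [Nonempty D.Letter] (L : Set (LocalCascade.Trace D)) :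
    (∃ β : LocalCascade.TraceFormula D, β.YFree ∧ L = β.language) ↔
      ∃ A : LocalCascade.AsyncAutomaton D, LocalCascade.IsU2Cascade D A ∧ A.Accepts L := by
  constructor
  · rintro ⟨β, hβ, rfl⟩
    obtain ⟨i, -⟩ := D.exists_mem_sub (Classical.arbitrary D.Letter)
    obtain ⟨A, hA, -, hL⟩ := β.exists_cascade_accepts hβ _
      (.single D _ i (LocalCascade.sinceAutomaton_isU2 D i ∅ ∅))
    exact ⟨A, hA, hL⟩
  · rintro ⟨A, hA, hL⟩
    obtain ⟨β, hβ, h⟩ := (hA.lettersDefinable inferInstance).traceDefinable_of_accepts hL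
    exact ⟨β, hβ, Set.ext fun t => (h t).symm⟩
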